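/- Let $U=\{z\in\mathbb C:\operatorname{Re}z>0\}$. A function $Q$ on $\{y: y+1\in U\}$ is called a Müller–Schleicher (MS) primitive of $g:U\to\mathbb C$ if there are polynomials $(P_n)_{n\in\mathbb N}$ of uniformly bounded degree such that for all $y$ with $y+1\in U$ $$\lim_{n\to\infty}\Bigl(\sum_{k=1}^{n}\bigl(g(k+y)-g(k)\bigr)-P_n(y)\Bigr)=-Q(y),\qquad Q(y+1)-Q(y)=g(y+1).$$ If such a $Q$ exists, it is unique up to an additive constant, $g$ is called MS-summable, and $(\mathrm{MS})\text{-}\sum_{k=x}^{y}g(k):=Q(y)-Q(x-1)$ for $x,y+1\in U$. For $p\in\mathbb N=\{0,1,2,\dots\}$ let $\mathcal T^{(p-1)}_{-2\pi,0;2\pi,0}$ be the set of holomorphic functions $f$ on $U$ such that 1. for every $t\in U$, $\int_{-\infty}^{\infty}|f(t+\mathrm i\xi)|\,\mathrm e^{-2\pi|\xi|}\,\mathrm d\xi<\infty$; 2. $\displaystyle\lim_{\operatorname{Re}t\to\infty}\int_{-\infty}^{\infty}\Bigl|f(t+\mathrm i\xi)-\sum_{k=0}^{p-1}\frac{f^{(k)}(t)}{k!}(\mathrm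 i\xi)^k\Bigr|\,\mathrm e^{-2\pi|\xi|}\,\mathrm d\xi=0$, locally uniformly in $\operatorname{Im}t$; 3. $|f(z)|\le C(\operatorname{Re}z)\,\mathrm e^{s|\operatorname{Im}z|}$ on $U$ for some $s\in\mathbb R$ and some locally bounded $C:(0,\infty)\to\mathbb R$. **Corollary.** Let $M\in\mathbb N$, let $b_1,\dots,b_M$ and $a_0,a_1,\dots$ be complex numbers, and let $$f(z)=\sum_{m=1}^{M}b_mz^{-m}+\sum_{n=0}^{\infty}\frac{a_n}{n!}z^n\qquad(\operatorname{Re}z>0).$$ Suppose that $\sum_{n=0}^\infty(2\pi)^{-n}|a_n|<\infty$ and that there is a $p\in\mathbb N$ with $f\in\mathcal T^{(p-1)}_{-2\pi,0;2\pi,0}$ and $\lim_{t\to\infty}f^{(p)}(t+\mathrm i\xi)=0$ ($t$ real) locally uniformly in $\xi\in\mathbb R$. Then $f$, each $b_mz^{-m}$ and each $\frac{a_n}{n!}z^n$ are MS-summable, and for all $\alpha,\beta\in\mathbb C$ with $\operatorname{Re}\alpha,\operatorname{Re}\beta>-1$ $$(\mathrm{MS})\text{-}\sum_{k=\alpha+1}^{\beta}f(k)=\sum_{m=1}^{M}\Bigl((\mathrm{MS})\text{-}\sum_{k=\alpha+1}^{\beta}b_mk^{-m}\Bigr)+\sum_{n=0}^{\infty}\Bigl((\mathrm{MS})\text{-}\sum_{k=\alpha+1}^{\beta}\frac{a_n}{n!}k^n\Bigr),$$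 where the last series converges absolutely. -/

import Mathlib

open Filter Topology MeasureTheory
open scoped Nat

namespace FracSum

/-- The open right half-plane `{z : Re z > 0}`. -/
def rightHalfPlane : Set ℂ := {z : ℂ | 0 < z.re}

/-- Admissible domains of summation: `1 ∈ U` and `U + 1 ⊆ U`. -/
structure IsMSDomain (U : Set ℂ) : Prop where
  one_mem : (1 : ℂ) ∈ U
  add_one_mem : ∀ z ∈ U, z + 1 ∈ U

theorem isMSDomain_rightHalfPlane : IsMSDomain rightHalfPlane where
  one_mem := by simp [rightHalfPlane]
  add_one_mem z hz := by
    simp only [rightHalfPlane, Set.mem_ofPred_eq, Complex.add_re, Complex.one_re] at hz ⊢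
    linarith

/-- `Q` is a Müller–Schleicher primitive of `f` on `U`: for some polynomials `P n` of uniformly
bounded degree and every `y` with `y + 1 ∈ U`, the sequence
`∑_{k=1}^n (f (k + y) - f k) - P n (y)` converges to `-Q y`, and `Q (y + 1) - Q y = f (y + 1)`. -/
structure IsMSPrimitive (U : Set ℂ) (f Q : ℂ → ℂ) : Prop where
  limit : ∃ P : ℕ → Polynomial ℂ, (∃ d : ℕ, ∀ n, (P n).natDegree ≤ d) ∧
    ∀ y : ℂ, y + 1 ∈ U →
      Tendsto
        (fun n : ℕ => (∑ k ∈ Finset.Icc 1 n, (f ((k : ℂ) + y) - f (k : ℂ))) - (P n).eval y)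
        atTop (𝓝 (-(Q y)))
  step : ∀ y : ℂ, y + 1 ∈ U → Q (y + 1) - Q y = f (y + 1)

/-- The Müller–Schleicher fractional sums of `f` on `U` exist. -/
def MSSummable (U : Set ℂ) (f : ℂ → ℂ) : Prop :=
  ∃ Q : ℂ → ℂ, IsMSPrimitive U f Q

open Classical in
/-- The Müller–Schleicher fractional sum `(MS)-∑_{k=x}^{y} f(k) = Q y - Q (x - 1)`, for
`x ∈ U` and `y + 1 ∈ U` (and `0` if `f` is not summable). By `IsMSPrimitive.sub_eq_sub` below,
the value does not depend on the choice of `Q`. -/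
noncomputable def msSum (U : Set ℂ) (f : ℂ → ℂ) (x y : ℂ) : ℂ :=
  if h : MSSummable U f then h.choose y - h.choose (x - 1) else 0

/-- A pointwise limit, on a set containing `ℕ`, of polynomials of bounded degree is a
polynomial. -/
theorem exists_polynomial_of_tendsto {S : Set ℂ} (hS : ∀ k : ℕ, (k : ℂ) ∈ S)
    {P : ℕ → Polynomial ℂ} {d : ℕ} (hP : ∀ n, (P n).natDegree ≤ d) {D : ℂ → ℂ}
    (hD : ∀ y ∈ S, Tendsto (fun n => (P n).eval y) atTop (𝓝 (D y))) :
    ∃ R : Polynomial ℂ, ∀ y ∈ S, D y = R.eval y := by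
  have hinj : Set.InjOn (fun k : ℕ => (k : ℂ)) (Finset.range (d + 1) : Finset ℕ) :=
    fun a _ b _ h => Nat.cast_injective (R := ℂ) h
  refine ⟨Lagrange.interpolate (Finset.range (d + 1)) (fun k : ℕ => (k : ℂ))
    (fun k => D (k : ℂ)), fun y hy => ?_⟩
  refine tendsto_nhds_unique (hD y hy) ?_
  have key : ∀ n, (P n).eval y = ∑ k ∈ Finset.range (d + 1), (P n).eval (k : ℂ) *
      (Lagrange.basis (Finset.range (d + 1)) (fun k : ℕ => (k : ℂ)) k).eval y := by
    intro n
    have hdeg : (P n).degree < (Finset.range (d + 1)).card := by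
      rw [Finset.card_range]
      refine lt_of_le_of_lt Polynomial.degree_le_natDegree ?_
      exact_mod_cast Nat.lt_succ_of_le (hP n)
    have h := Lagrange.eq_interpolate hinj hdeg
    conv_lhs => rw [h]
    simp [Lagrange.interpolate_apply, Polynomial.eval_finsetSum]
  simp only [key, Lagrange.interpolate_apply, Polynomial.eval_finsetSum, Polynomial.eval_mul,
    Polynomial.eval_C]
  exact tendsto_finsetSum _ fun k _ => (hD _ (hS k)).mul_const _

/-- Primitives are unique up to an additive constant, so `msSum` is well defined. -/
theorem IsMSPrimitive.sub_eq_sub {U : Set ℂ} (hU : IsMSDomain U) {f Q Q' : ℂ → ℂ}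
    (h : IsMSPrimitive U f Q) (h' : IsMSPrimitive U f Q') {x y : ℂ} (hx : x ∈ U)
    (hy : y + 1 ∈ U) : Q y - Q (x - 1) = Q' y - Q' (x - 1) := by
  obtain ⟨P, ⟨d, hd⟩, hP⟩ := h.limit
  obtain ⟨P', ⟨d', hd'⟩, hP'⟩ := h'.limit
  have hS : ∀ k : ℕ, (k : ℂ) ∈ {y : ℂ | y + 1 ∈ U} := by
    intro k
    induction k with
    | zero => simpa using hU.one_mem
    | succ k ih =>
      have := hU.add_one_mem _ ih
      simpa using this
  obtain ⟨R, hR⟩ := exists_polynomial_of_tendsto (P := fun n => P n - P' n)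
    (d := max d d') (D := fun y => Q y - Q' y) hS
    (fun n => (Polynomial.natDegree_sub_le _ _).trans (max_le_max (hd n) (hd' n)))
    (fun y hy => by
      have := (hP' y hy).sub (hP y hy)
      refine (this.congr fun n => ?_).trans (by rw [neg_sub_neg])
      simp)
  have hnat : ∀ k : ℕ, R.eval (k : ℂ) = R.eval 0 := by
    intro k
    induction k with
    | zero => simp
    | succ k ih =>
      have e1 := hR _ (hS k)
      have e2 := hR _ (hS (k + 1))
      have s1 := h.step _ (hS k)
      have s2 := h'.step _ (hS k)
      push_cast at e2 ⊢
      rw [← ih, ← e1, ← e2]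
      linear_combination s1 - s2
  have hconst : R = Polynomial.C (R.eval 0) := by
    refine Polynomial.eq_of_infinite_eval_eq _ _ ?_
    refine (Set.infinite_range_of_injective (Nat.cast_injective (R := ℂ))).mono ?_
    rintro _ ⟨k, rfl⟩
    simpa using hnat k
  have e1 := hR y hy
  have e2 := hR (x - 1) (by simpa using hx)
  rw [hconst, Polynomial.eval_C] at e1 e2
  linear_combination e1 - e2

/-- The remainder `f (t + iξ) - ∑_{k<p} f^{(k)}(t) / k! * (iξ)^k` of the Taylor expansion of `f`
at `t` of order `p - 1` (no term is subtracted for `p = 0`). -/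
noncomputable def taylorRemainder (f : ℂ → ℂ) (p : ℕ) (t : ℂ) (ξ : ℝ) : ℂ :=
  f (t + ξ * Complex.I) -
    ∑ k ∈ Finset.range p, iteratedDeriv k f t / (k ! : ℂ) * (ξ * Complex.I) ^ k

/-- The class `𝒯^{(p-1)}_{a,k;b,l}` of holomorphic functions on the right half-plane. The Lean
parameter `p` is a natural number, so that the upper index `p - 1` ranges over `-1, 0, 1, …`.
The limits as `Re t → ∞` are locally uniform in `Im t = η`. -/
structure MemT (p : ℕ) (a k b l : ℝ) (f : ℂ → ℂ) : Prop where
  holo : DifferentiableOn ℂ f rightHalfPlane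
  integrable_pos : ∀ t : ℂ, 0 < t.re → IntegrableOn
    (fun ξ : ℝ => ‖f (t + ξ * Complex.I)‖ * (Real.exp (-b * ξ) * (1 + |ξ|) ^ l)) (Set.Ioi 0)
  limit_pos : ∀ K : Set ℝ, IsCompact K → ∀ ε : ENNReal, 0 < ε → ∀ᶠ x : ℝ in atTop, ∀ η ∈ K,
    ∫⁻ ξ in Set.Ioi (0 : ℝ), ENNReal.ofReal
      (‖taylorRemainder f p (x + η * Complex.I) ξ‖ * (Real.exp (-b * ξ) * (1 + |ξ|) ^ l)) < ε
  integrable_neg : ∀ t : ℂ, 0 < t.re → IntegrableOn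
    (fun ξ : ℝ => ‖f (t + ξ * Complex.I)‖ * (Real.exp (-a * ξ) * (1 + |ξ|) ^ k)) (Set.Iio 0)
  limit_neg : ∀ K : Set ℝ, IsCompact K → ∀ ε : ENNReal, 0 < ε → ∀ᶠ x : ℝ in atTop, ∀ η ∈ K,
    ∫⁻ ξ in Set.Iio (0 : ℝ), ENNReal.ofReal
      (‖taylorRemainder f p (x + η * Complex.I) ξ‖ * (Real.exp (-a * ξ) * (1 + |ξ|) ^ k)) < ε
  exp_type : ∃ (s : ℝ) (C : ℝ → ℝ),
    (∀ K : Set ℝ, IsCompact K → K ⊆ Set.Ioi 0 → BddAbove (C '' K)) ∧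
    ∀ z : ℂ, 0 < z.re → ‖f z‖ ≤ C z.re * Real.exp (s * |z.im|)

end FracSum

/-! The Bernoulli polynomials are moments of the logistic density
`w(ξ) = (π / 2) sech² (π ξ)`:
`B_n(x + 1/2) = ∫ (x + iξ) ^ n w(ξ) dξ` (`integral_add_mul_I_pow_mul_logisticDensity`).
Since `w(ξ) ≤ 2π exp (-2π|ξ|)`, the growth assumption on `a` is exactly what allows summing these
integrals against `a n / n!`. Hence the termwise primitive
`G(y) = ∑ a n / n! * B_{n+1}(y + 1) / (n + 1)` of the entire part `g` of `f` converges absolutely,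
solves `G(y + 1) - G(y) = g(y + 1)`, and has derivative `G'(y) = ∫ g(y + 1/2 + iξ) w(ξ) dξ`
(`hasDerivAt_tsum_bernoulliPrimitive`).

It remains to see that `G` is an MS primitive of `g`. By telescoping (`IsMSPrimitive.of_step`), this
says that `G(n + y) - G(n)` is polynomial in `y` up to `o(1)` as `n → ∞`
(`exists_polynomial_tendsto_sub`). Indeed, membership in `𝒯` bounds, on the line through
`t = n + 1/2 + y`, the logistic average of the Taylor remainder of `f`, so `G'(n + y)` is
`∑_{k<p} μ_k / k! * f^{(k)}(t) + o(1)` with the logistic moments `μ_k`, locally uniformly in `y`;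
the contribution of the negative powers tends to `0`. As `f^{(p)} → 0`, each `f^{(k)}(t)` is within
`o(1)` of its Taylor polynomial in `y` of degree `p - 1 - k`, and integrating in `y` gives the claim.

The negative powers have the explicit primitives
`-∑_{k≥1} (b (k + y) ^ (-m) - b k ^ (-m))`. The sum of these primitives and `G` is a primitive of
`f`, and uniqueness of primitives up to constants turns this into the asserted identity. -/


namespace FracSum

/-! ### Bernoulli polynomials as logistic moments -/

theorem integral_pow_mul_exp_neg (n : ℕ) {c : ℝ} (hc : 0 < c) :
    ∫ x in Set.Ioi (0 : ℝ), x ^ n * Real.exp (-(c * x)) = n ! / c ^ (n + 1) := by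
  have h := Real.integral_rpow_mul_exp_neg_mul_Ioi (a := n + 1) (r := c) (by positivity) hc
  rw [Real.Gamma_nat_eq_factorial] at h
  simp only [add_sub_cancel_right, Real.rpow_natCast] at h
  rw [h, show ((n : ℝ) + 1) = ((n + 1 : ℕ) : ℝ) by push_cast; ring, Real.rpow_natCast]
  rw [div_pow, one_pow]; ring

/-- Integrability follows from the value of the integral: it is nonzero, whereas the integral of a
non-integrable function is `0` by convention. -/
theorem integrableOn_pow_mul_exp_neg (n : ℕ) {c : ℝ} (hc : 0 < c) :
    IntegrableOn (fun x : ℝ => x ^ n * Real.exp (-(c * x))) (Set.Ioi 0) :=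
  .of_integral_ne_zero (by rw [integral_pow_mul_exp_neg n hc]; positivity)

theorem integral_abs_pow_mul_exp_neg (n : ℕ) {c : ℝ} (hc : 0 < c) :
    ∫ x : ℝ, |x| ^ n * Real.exp (-(c * |x|)) = 2 * (n ! / c ^ (n + 1)) := by
  rw [integral_comp_abs (f := fun x => x ^ n * Real.exp (-(c * x))), integral_pow_mul_exp_neg n hc]

theorem integrable_abs_pow_mul_exp_neg (n : ℕ) {c : ℝ} (hc : 0 < c) :
    Integrable (fun x : ℝ => |x| ^ n * Real.exp (-(c * |x|))) :=
  .of_integral_ne_zero (by rw [integral_abs_pow_mul_exp_neg n hc]; positivity)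

/-- The logistic density `(π / 2) sech² (π ξ)`, written in terms of `exp (-2π|ξ|)`. -/
noncomputable def logisticDensity (ξ : ℝ) : ℝ :=
  2 * Real.pi * Real.exp (-(2 * Real.pi * |ξ|)) / (1 + Real.exp (-(2 * Real.pi * |ξ|))) ^ 2

theorem logisticDensity_nonneg (ξ : ℝ) : 0 ≤ logisticDensity ξ := by
  unfold logisticDensity; positivity

theorem logisticDensity_le (ξ : ℝ) :
    logisticDensity ξ ≤ 2 * Real.pi * Real.exp (-(2 * Real.pi * |ξ|)) := by
  unfold logisticDensity
  refine div_le_self (by positivity) (one_le_pow₀ ?_)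
  linarith [Real.exp_pos (-(2 * Real.pi * |ξ|))]

theorem continuous_logisticDensity : Continuous logisticDensity := by
  unfold logisticDensity
  refine Continuous.div (by fun_prop) (by fun_prop) fun x => ?_
  positivity

theorem logisticDensity_neg (ξ : ℝ) : logisticDensity (-ξ) = logisticDensity ξ := by
  simp [logisticDensity]

theorem integral_Ioi_logisticDensity : ∫ ξ in Set.Ioi (0 : ℝ), logisticDensity ξ = 1 / 2 := by
  have hd : ∀ x : ℝ, HasDerivAt (fun x => (1 + Real.exp (-(2 * Real.pi * x)))⁻¹)
      (2 * Real.pi * Real.exp (-(2 * Real.pi * x)) / (1 + Real.exp (-(2 * Real.pi * x))) ^ 2) x := by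
    intro x
    have h1 : HasDerivAt (fun x : ℝ => -(2 * Real.pi * x)) (-(2 * Real.pi * 1)) x :=
      ((hasDerivAt_id x).const_mul _).neg
    have h2 := (h1.exp.const_add 1).inv (by positivity)
    convert! h2 using 1
    ring
  have ht : Tendsto (fun x : ℝ => (1 + Real.exp (-(2 * Real.pi * x)))⁻¹) atTop (𝓝 (1 + 0)⁻¹) := by
    refine Tendsto.inv₀ (tendsto_const_nhds.add ?_) (by norm_num)
    refine Real.tendsto_exp_atBot.comp (tendsto_neg_atTop_atBot.comp ?_)
    exact tendsto_id.const_mul_atTop (by positivity)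
  have h := integral_Ioi_of_hasDerivAt_of_nonneg' (a := 0) (fun x _ => hd x)
    (fun x _ => by positivity) ht
  norm_num at h
  rw [← h]
  refine setIntegral_congr_fun measurableSet_Ioi fun x hx => ?_
  simp [logisticDensity, abs_of_pos (Set.mem_Ioi.1 hx)]

/-- The positive even moments of the logistic density, obtained by integrating the series
`q / (1 + q) ^ 2 = ∑ j (-1) ^ (j + 1) q ^ j` termwise and summing `∑ (-1) ^ j / j ^ (2 k)`
with the Fourier series of the Bernoulli polynomials at `1 / 2`. -/
theorem integral_Ioi_pow_mul_logisticDensity {k : ℕ} (hk : k ≠ 0) :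
    ∫ ξ in Set.Ioi (0 : ℝ), ξ ^ (2 * k) * logisticDensity ξ =
      (-1) ^ k * bernoulliFun (2 * k) (1 / 2) / 2 := by
  set F : ℕ → ℝ → ℝ := fun j ξ =>
    -(2 * Real.pi * (-1) ^ j * j) * (ξ ^ (2 * k) * Real.exp (-(2 * Real.pi * j * ξ))) with hF
  have hint : ∀ j, Integrable (F j) (volume.restrict (Set.Ioi 0)) := by
    intro j
    rcases Nat.eq_zero_or_pos j with rfl | hj
    · simp [hF]
    · exact (integrableOn_pow_mul_exp_neg (2 * k) (by positivity)).const_mul _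
  have hval : ∀ j, ∫ ξ in Set.Ioi (0 : ℝ), F j ξ =
      -((2 * k)! / (2 * Real.pi) ^ (2 * k) * ((-1) ^ j * (1 / (j : ℝ) ^ (2 * k)))) := by
    intro j
    rcases Nat.eq_zero_or_pos j with rfl | hj
    · simp [hF, hk]
    · simp only [hF]
      rw [integral_const_mul, integral_pow_mul_exp_neg _ (by positivity)]
      field_simp
      ring
  have hnorm : ∀ j, ∫ ξ in Set.Ioi (0 : ℝ), ‖F j ξ‖ =
      (2 * k)! / (2 * Real.pi) ^ (2 * k) * (1 / (j : ℝ) ^ (2 * k)) := by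
    intro j
    have : ∀ ξ ∈ Set.Ioi (0 : ℝ), ‖F j ξ‖ = (2 * Real.pi * j) *
        (ξ ^ (2 * k) * Real.exp (-(2 * Real.pi * j * ξ))) := by
      intro ξ hξ
      have : (0 : ℝ) < ξ := hξ
      simp [hF, abs_of_pos Real.pi_pos, abs_of_pos this]
    rw [setIntegral_congr_fun measurableSet_Ioi this]
    rcases Nat.eq_zero_or_pos j with rfl | hj
    · simp [hk]
    · rw [integral_const_mul, integral_pow_mul_exp_neg _ (by positivity)]
      field_simp
      ring
  have hsum : Summable fun j => ∫ ξ in Set.Ioi (0 : ℝ), ‖F j ξ‖ := by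
    simp_rw [hnorm]
    exact (Real.summable_one_div_nat_pow.2 (by omega)).mul_left _
  have key := hasSum_integral_of_summable_integral_norm hint hsum
  have hpt : ∀ ξ ∈ Set.Ioi (0 : ℝ), ∑' j, F j ξ = ξ ^ (2 * k) * logisticDensity ξ := by
    intro ξ hξ
    have hξ' : (0 : ℝ) < ξ := hξ
    set q := Real.exp (-(2 * Real.pi * ξ)) with hq
    have hq1 : q < 1 := Real.exp_lt_one_iff.2 (by have := Real.pi_pos; nlinarith [mul_pos this hξ'])
    have hq0 : 0 < q := Real.exp_pos _
    have h := hasSum_coe_mul_geometric_of_norm_lt_one (r := -q)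
      (by rw [norm_neg, Real.norm_of_nonneg hq0.le]; exact hq1)
    have h2 := h.mul_left (-(2 * Real.pi * ξ ^ (2 * k)))
    have h3 : HasSum (fun j => F j ξ)
        (-(2 * Real.pi * ξ ^ (2 * k)) * (-q / (1 - -q) ^ 2)) := by
      convert! h2 using 1
      funext j
      have : Real.exp (-(2 * Real.pi * j * ξ)) = q ^ j := by
        rw [hq, ← Real.exp_nat_mul]; ring_nf
      simp only [hF, this, neg_pow q]
      ring
    rw [h3.tsum_eq, logisticDensity, abs_of_pos hξ', ← hq]
    rw [sub_neg_eq_add]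
    ring
  rw [setIntegral_congr_fun measurableSet_Ioi hpt] at key
  simp_rw [hval] at key
  have hz := hasSum_one_div_nat_pow_mul_cos hk (x := 1 / 2) ⟨by norm_num, by norm_num⟩
  have hcos : ∀ n : ℕ, Real.cos (2 * Real.pi * n * (1 / 2)) = (-1) ^ n := by
    intro n
    rw [show 2 * Real.pi * n * (1 / 2) = n * Real.pi by ring, Real.cos_nat_mul_pi]
  simp_rw [hcos] at hz
  have hz' := (hz.mul_left ((2 * k)! / (2 * Real.pi) ^ (2 * k) : ℝ)).neg
  have := key.unique (hz'.congr_fun fun j => by ring)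
  rw [this, bernoulliFun]
  field_simp
  ring

theorem integrable_add_abs_pow_mul_exp_neg (r : ℝ) (n : ℕ) :
    Integrable fun ξ : ℝ => (r + |ξ|) ^ n * (2 * Real.pi * Real.exp (-(2 * Real.pi * |ξ|))) := by
  simp_rw [add_pow, Finset.sum_mul]
  refine integrable_finsetSum _ fun k _ => ?_
  have := (integrable_abs_pow_mul_exp_neg (n - k) (c := 2 * Real.pi) (by positivity)).const_mul
    (r ^ k * n.choose k * (2 * Real.pi))
  refine this.congr (ae_of_all _ fun ξ => ?_)
  ring

/-- The bound on absolute moments that yields `B_n(x) = O(n! / (2π) ^ n)`, locally uniformly in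
complex `x`. -/
theorem integral_add_abs_pow_mul_exp_neg_le {r : ℝ} (hr : 0 ≤ r) (n : ℕ) :
    ∫ ξ : ℝ, (r + |ξ|) ^ n * (2 * Real.pi * Real.exp (-(2 * Real.pi * |ξ|))) ≤
      2 * Real.exp (2 * Real.pi * r) * (n ! / (2 * Real.pi) ^ n) := by
  have e : ∀ ξ : ℝ, (r + |ξ|) ^ n * (2 * Real.pi * Real.exp (-(2 * Real.pi * |ξ|))) =
      ∑ k ∈ Finset.range (n + 1), (r ^ k * n.choose k * (2 * Real.pi)) *
        (|ξ| ^ (n - k) * Real.exp (-(2 * Real.pi * |ξ|))) := by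
    intro ξ
    rw [add_pow, Finset.sum_mul]
    exact Finset.sum_congr rfl fun k _ => by ring
  simp_rw [e]
  rw [integral_finsetSum _ fun k _ =>
    (integrable_abs_pow_mul_exp_neg (n - k) (c := 2 * Real.pi) (by positivity)).const_mul _]
  have hterm : ∀ k ∈ Finset.range (n + 1),
      ∫ ξ : ℝ, (r ^ k * n.choose k * (2 * Real.pi)) *
        (|ξ| ^ (n - k) * Real.exp (-(2 * Real.pi * |ξ|))) =
      2 * (n ! / (2 * Real.pi) ^ n) * ((2 * Real.pi * r) ^ k / k !) := by
    intro k hk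
    have hk' : k ≤ n := by simpa [Nat.lt_succ_iff] using hk
    rw [integral_const_mul, integral_abs_pow_mul_exp_neg _ (by positivity),
      Nat.cast_choose ℝ hk', mul_pow]
    obtain ⟨m, rfl⟩ := Nat.exists_eq_add_of_le hk'
    have hpi := Real.pi_pos.ne'
    simp only [add_tsub_cancel_left]
    field_simp
    ring
  rw [Finset.sum_congr rfl hterm, ← Finset.mul_sum]
  have := Real.sum_le_exp_of_nonneg (x := 2 * Real.pi * r) (by positivity) (n + 1)
  calc _ ≤ 2 * (n ! / (2 * Real.pi) ^ n) * Real.exp (2 * Real.pi * r) := by gcongr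
    _ = _ := by ring

theorem norm_add_mul_I_pow_mul_logisticDensity_le (x : ℂ) (n : ℕ) (ξ : ℝ) :
    ‖(x + ξ * Complex.I) ^ n * (logisticDensity ξ : ℂ)‖ ≤
      (‖x‖ + |ξ|) ^ n * (2 * Real.pi * Real.exp (-(2 * Real.pi * |ξ|))) := by
  rw [norm_mul, norm_pow, Complex.norm_real, Real.norm_of_nonneg (logisticDensity_nonneg _)]
  gcongr
  · exact logisticDensity_nonneg _
  · refine (norm_add_le _ _).trans ?_
    simp
  · exact logisticDensity_le _

theorem integrable_add_mul_I_pow_mul_logisticDensity (x : ℂ) (n : ℕ) :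
    Integrable fun ξ : ℝ => (x + ξ * Complex.I) ^ n * (logisticDensity ξ : ℂ) := by
  refine (integrable_add_abs_pow_mul_exp_neg ‖x‖ n).mono' ?_
    (ae_of_all _ fun ξ => norm_add_mul_I_pow_mul_logisticDensity_le x n ξ)
  have := continuous_logisticDensity
  fun_prop

theorem integral_norm_pow_mul_logisticDensity_le (x : ℂ) (n : ℕ) :
    ∫ ξ : ℝ, ‖(x + ξ * Complex.I) ^ n * (logisticDensity ξ : ℂ)‖ ≤
      2 * Real.exp (2 * Real.pi * ‖x‖) * (n ! / (2 * Real.pi) ^ n) :=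
  (integral_mono (integrable_add_mul_I_pow_mul_logisticDensity x n).norm
    (integrable_add_abs_pow_mul_exp_neg ‖x‖ n)
    (norm_add_mul_I_pow_mul_logisticDensity_le x n)).trans
    (integral_add_abs_pow_mul_exp_neg_le (norm_nonneg x) n)

theorem integral_mul_I_pow_mul_logisticDensity (n : ℕ) :
    ∫ ξ : ℝ, ((ξ : ℂ) * Complex.I) ^ n * (logisticDensity ξ : ℂ) =
      (bernoulliFun n (1 / 2) : ℂ) := by
  rcases Nat.even_or_odd' n with ⟨k, rfl | rfl⟩
  · have e : ∀ ξ : ℝ, ((ξ : ℂ) * Complex.I) ^ (2 * k) * (logisticDensity ξ : ℂ) =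
        (((-1) ^ k * (|ξ| ^ (2 * k) * logisticDensity |ξ|) : ℝ) : ℂ) := by
      intro ξ
      have : |ξ| ^ (2 * k) = ξ ^ (2 * k) := by rw [pow_mul, sq_abs, ← pow_mul]
      rw [this]
      have h2 : logisticDensity |ξ| = logisticDensity ξ := by simp [logisticDensity]
      rw [h2, mul_pow, pow_mul Complex.I, Complex.I_sq]
      push_cast
      ring
    simp_rw [e]
    rw [integral_complex_ofReal, integral_const_mul,
      integral_comp_abs (f := fun ξ => ξ ^ (2 * k) * logisticDensity ξ)]
    congr 1
    rcases eq_or_ne k 0 with rfl | hk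
    · simp [integral_Ioi_logisticDensity]
    · rw [integral_Ioi_pow_mul_logisticDensity hk]
      have : ((-1 : ℝ) ^ k) * (-1) ^ k = 1 := by rw [← mul_pow]; simp
      linear_combination (bernoulliFun (2 * k) (1 / 2)) * this
  · rw [one_div, bernoulliFun_eval_half_eq_zero]
    have h := integral_neg_eq_self
      (fun ξ : ℝ => ((ξ : ℂ) * Complex.I) ^ (2 * k + 1) * (logisticDensity ξ : ℂ)) volume
    have e : ∀ ξ : ℝ, ((((-ξ : ℝ) : ℂ)) * Complex.I) ^ (2 * k + 1) * (logisticDensity (-ξ) : ℂ) =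
        -(((ξ : ℂ) * Complex.I) ^ (2 * k + 1) * (logisticDensity ξ : ℂ)) := by
      intro ξ
      rw [logisticDensity_neg, Complex.ofReal_neg, neg_mul, Odd.neg_pow ⟨k, rfl⟩, neg_mul]
    simp_rw [e] at h
    rw [integral_neg] at h
    simpa using self_eq_neg.1 h.symm

theorem iterate_derivative_bernoulli (n k : ℕ) :
    (Polynomial.derivative^[k]) (Polynomial.bernoulli n) =
      (n.descFactorial k : Polynomial ℚ) * Polynomial.bernoulli (n - k) := by
  induction k with
  | zero => simp
  | succ k ih =>
    rw [Function.iterate_succ_apply', ih, Polynomial.derivative_natCast_mul,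
      Polynomial.derivative_bernoulli, Nat.descFactorial_succ, Nat.sub_sub]
    push_cast
    ring

theorem natDegree_bernoulli_le (n : ℕ) : (Polynomial.bernoulli n).natDegree ≤ n := by
  refine Polynomial.natDegree_le_iff_coeff_eq_zero.2 fun i hi => ?_
  rw [Polynomial.coeff_bernoulli, if_neg (by omega)]

/-- The addition theorem for Bernoulli polynomials. -/
theorem bernoulli_eval_add (n : ℕ) (x y : ℂ) :
    Polynomial.aeval (x + y) (Polynomial.bernoulli n) =
      ∑ k ∈ Finset.range (n + 1),
        x ^ k * Polynomial.aeval y (Polynomial.bernoulli (n - k)) * (n.choose k : ℂ) := by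
  set B : Polynomial ℂ := (Polynomial.bernoulli n).map (algebraMap ℚ ℂ) with hB
  have hdeg : (Polynomial.taylor y B).natDegree < n + 1 := by
    rw [Polynomial.natDegree_taylor]
    exact Nat.lt_succ_of_le (Polynomial.natDegree_map_le.trans (natDegree_bernoulli_le n))
  have h := Polynomial.taylor_eval y B x
  rw [Polynomial.eval_eq_sum_range' hdeg] at h
  rw [Polynomial.aeval_def, ← Polynomial.eval_map, ← hB, ← h]
  refine Finset.sum_congr rfl fun k _ => ?_
  rw [Polynomial.taylor_coeff]
  have h1 : (k ! : ℂ) * (Polynomial.hasseDeriv k B).eval y =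
      (n.descFactorial k : ℂ) * Polynomial.aeval y (Polynomial.bernoulli (n - k)) := by
    have h2 := congrArg (Polynomial.eval y)
      (congrFun (Polynomial.factorial_smul_hasseDeriv (R := ℂ) (k := k)) B)
    rw [LinearMap.smul_apply, hB, Polynomial.iterate_derivative_map,
      iterate_derivative_bernoulli] at h2
    simpa [Polynomial.aeval_def, Polynomial.eval_map] using h2
  rw [Nat.descFactorial_eq_factorial_mul_choose] at h1
  have hk : (k ! : ℂ) ≠ 0 := by exact_mod_cast k.factorial_ne_zero
  have h3 : (Polynomial.hasseDeriv k B).eval y =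
      (n.choose k : ℂ) * Polynomial.aeval y (Polynomial.bernoulli (n - k)) := by
    apply mul_left_cancel₀ hk
    rw [h1]; push_cast; ring
  rw [h3]; ring

/-- Bernoulli polynomials are the moments of the logistic distribution on the vertical line
through `x`, shifted by `1 / 2`. -/
theorem integral_add_mul_I_pow_mul_logisticDensity (x : ℂ) (n : ℕ) :
    ∫ ξ : ℝ, (x + ξ * Complex.I) ^ n * (logisticDensity ξ : ℂ) =
      Polynomial.aeval (x + 1 / 2) (Polynomial.bernoulli n) := by
  rw [bernoulli_eval_add]
  have e : ∀ ξ : ℝ, (x + ξ * Complex.I) ^ n * (logisticDensity ξ : ℂ) =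
      ∑ k ∈ Finset.range (n + 1), (x ^ k * (n.choose k : ℂ)) *
        (((ξ : ℂ) * Complex.I) ^ (n - k) * (logisticDensity ξ : ℂ)) := by
    intro ξ
    rw [add_pow, Finset.sum_mul]
    exact Finset.sum_congr rfl fun k _ => by ring
  simp_rw [e]
  have hi : ∀ m : ℕ, Integrable fun ξ : ℝ =>
      ((ξ : ℂ) * Complex.I) ^ m * (logisticDensity ξ : ℂ) := fun m => by
    simpa using integrable_add_mul_I_pow_mul_logisticDensity 0 m
  rw [integral_finsetSum _ fun k _ => (hi _).const_mul _]
  refine Finset.sum_congr rfl fun k _ => ?_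
  rw [integral_const_mul, integral_mul_I_pow_mul_logisticDensity]
  have : (bernoulliFun (n - k) (1 / 2) : ℂ) =
      Polynomial.aeval (1 / 2 : ℂ) (Polynomial.bernoulli (n - k)) := by
    rw [bernoulliFun, Polynomial.eval_map_algebraMap]
    have := Polynomial.aeval_algebraMap_apply ℂ (1 / 2 : ℝ) (Polynomial.bernoulli (n - k))
    simp only [Complex.coe_algebraMap] at this
    rw [← this]
    norm_num
  rw [this]; ring

theorem bernoulli_aeval_add_one (n : ℕ) (x : ℂ) :
    Polynomial.aeval (x + 1) (Polynomial.bernoulli n) =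
      Polynomial.aeval x (Polynomial.bernoulli n) + n * x ^ (n - 1) := by
  have h := congrArg (Polynomial.aeval x) (Polynomial.bernoulli_comp_one_add_X n)
  rw [Polynomial.aeval_comp] at h
  simpa [add_comm x 1] using h

/-! ### The termwise primitive of the entire part -/

/-- The normalised Bernoulli polynomial `B_{n+1}(y + 1) / (n + 1)`, an MS primitive of `z ^ n`. -/
noncomputable def bernoulliPrimitive (n : ℕ) (y : ℂ) : ℂ :=
  Polynomial.aeval (y + 1) (Polynomial.bernoulli (n + 1)) / (n + 1)

theorem bernoulliPrimitive_step (n : ℕ) (y : ℂ) :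
    bernoulliPrimitive n (y + 1) - bernoulliPrimitive n y = (y + 1) ^ n := by
  have : (n : ℂ) + 1 ≠ 0 := by exact_mod_cast n.succ_ne_zero
  rw [bernoulliPrimitive, bernoulliPrimitive, bernoulli_aeval_add_one]
  push_cast
  field_simp
  ring

theorem hasDerivAt_bernoulliPrimitive (n : ℕ) (y : ℂ) :
    HasDerivAt (bernoulliPrimitive n) (Polynomial.aeval (y + 1) (Polynomial.bernoulli n)) y := by
  have h1 : (n : ℂ) + 1 ≠ 0 := by exact_mod_cast n.succ_ne_zero
  have h := ((Polynomial.bernoulli (n + 1)).hasDerivAt_aeval (y + 1)).comp_add_const y 1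
  refine (h.div_const ((n : ℂ) + 1)).congr_deriv ?_
  rw [Polynomial.derivative_bernoulli_add_one]
  simp only [map_mul, map_add, map_natCast, map_one]
  field_simp

theorem norm_aeval_bernoulli_le (n : ℕ) (y : ℂ) :
    ‖Polynomial.aeval (y + 1) (Polynomial.bernoulli n)‖ ≤
      2 * Real.exp (2 * Real.pi * ‖y + 1 / 2‖) * (n ! / (2 * Real.pi) ^ n) := by
  have h := integral_add_mul_I_pow_mul_logisticDensity (y + 1 / 2) n
  rw [show y + 1 / 2 + 1 / 2 = y + 1 by ring] at h
  rw [← h]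
  exact (norm_integral_le_integral_norm _).trans (integral_norm_pow_mul_logisticDensity_le _ n)

section Series

variable {a : ℕ → ℂ} (ha : Summable fun n : ℕ => (2 * Real.pi) ^ (-(n : ℤ)) * ‖a n‖)
include ha

theorem summable_norm_div_factorial_mul (C : ℝ) :
    Summable fun n : ℕ => ‖a n / (n ! : ℂ)‖ * (C * (n ! / (2 * Real.pi) ^ n)) := by
  refine (ha.mul_left C).congr fun n => ?_
  have : (n ! : ℝ) ≠ 0 := by exact_mod_cast n.factorial_ne_zero
  rw [norm_div, Complex.norm_natCast, zpow_neg, zpow_natCast]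
  field_simp

theorem summable_bernoulliPrimitive (y : ℂ) :
    Summable fun n : ℕ => a n / (n ! : ℂ) * bernoulliPrimitive n y := by
  refine Summable.of_norm_bounded (summable_norm_div_factorial_mul ha
    (2 * Real.exp (2 * Real.pi * ‖y + 1 / 2‖) / (2 * Real.pi))) fun n => ?_
  rw [norm_mul]
  gcongr
  have h := norm_aeval_bernoulli_le (n + 1) y
  have hn : ‖(n : ℂ) + 1‖ = n + 1 := by
    have := Complex.norm_natCast (n + 1)
    push_cast at this
    exact this
  rw [bernoulliPrimitive, norm_div, hn, div_le_iff₀ (by positivity)]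
  refine h.trans_eq ?_
  rw [Nat.factorial_succ]
  push_cast
  have := Real.pi_pos.ne'
  field_simp
  ring

/-- Termwise integration against the logistic density. The hypothesis on `a` is exactly what makes
this converge absolutely. -/
theorem hasSum_integral_entire_series (z : ℂ) :
    HasSum (fun n : ℕ => a n / (n ! : ℂ) *
        Polynomial.aeval (z + 1 / 2) (Polynomial.bernoulli n))
      (∫ ξ : ℝ, (∑' n : ℕ, a n / (n ! : ℂ) * (z + ξ * Complex.I) ^ n) *
        (logisticDensity ξ : ℂ)) := by
  have h := hasSum_integral_of_summable_integral_norm (μ := volume)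
    (F := fun (n : ℕ) (ξ : ℝ) => a n / (n ! : ℂ) *
      ((z + ξ * Complex.I) ^ n * (logisticDensity ξ : ℂ)))
    (fun n => (integrable_add_mul_I_pow_mul_logisticDensity z n).const_mul _)
    (by
      refine Summable.of_nonneg_of_le (fun n => integral_nonneg fun _ => norm_nonneg _)
        (fun n => ?_) (summable_norm_div_factorial_mul ha (2 * Real.exp (2 * Real.pi * ‖z‖)))
      simp_rw [norm_mul (a n / (n ! : ℂ))]
      rw [integral_const_mul]
      gcongr
      exact integral_norm_pow_mul_logisticDensity_le z n)
  simp_rw [integral_const_mul, integral_add_mul_I_pow_mul_logisticDensity, ← mul_assoc,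
    tsum_mul_right] at h
  exact h

/-- The termwise primitive of an entire series has derivative the logistic average of the series
over the vertical line through `y + 1 / 2`. -/
theorem hasDerivAt_tsum_bernoulliPrimitive (y : ℂ) :
    HasDerivAt (fun y => ∑' n : ℕ, a n / (n ! : ℂ) * bernoulliPrimitive n y)
      (∫ ξ : ℝ, (∑' n : ℕ, a n / (n ! : ℂ) * (y + 1 / 2 + ξ * Complex.I) ^ n) *
        (logisticDensity ξ : ℂ)) y := by
  have hy : y ∈ Metric.ball y 1 := Metric.mem_ball_self one_pos
  have h := hasDerivAt_tsum_of_isPreconnected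
    (g := fun (n : ℕ) y => a n / (n ! : ℂ) * bernoulliPrimitive n y)
    (g' := fun (n : ℕ) y => a n / (n ! : ℂ) * Polynomial.aeval (y + 1) (Polynomial.bernoulli n))
    (summable_norm_div_factorial_mul ha
      (2 * Real.exp (2 * Real.pi * (1 + ‖y + 1 / 2‖)))) Metric.isOpen_ball
    (convex_ball y 1).isPreconnected
    (fun n z _ => (hasDerivAt_bernoulliPrimitive n z).const_mul _)
    (fun n z hz => by
      rw [norm_mul]
      gcongr
      refine (norm_aeval_bernoulli_le n z).trans ?_
      gcongr
      calc ‖z + 1 / 2‖ = ‖(z - y) + (y + 1 / 2)‖ := by congr 1; ring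
        _ ≤ ‖z - y‖ + ‖y + 1 / 2‖ := norm_add_le _ _
        _ ≤ _ := by
          have : ‖z - y‖ < 1 := by simpa [dist_eq_norm] using hz
          linarith)
    hy (summable_bernoulliPrimitive ha y) hy
  refine h.congr_deriv ?_
  have h2 := (hasSum_integral_entire_series ha (y + 1 / 2)).tsum_eq
  rw [show y + 1 / 2 + 1 / 2 = y + 1 by ring] at h2
  exact h2

theorem tsum_bernoulliPrimitive_step (y : ℂ) :
    (∑' n : ℕ, a n / (n ! : ℂ) * bernoulliPrimitive n (y + 1)) -
      (∑' n : ℕ, a n / (n ! : ℂ) * bernoulliPrimitive n y) =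
        ∑' n : ℕ, a n / (n ! : ℂ) * (y + 1) ^ n := by
  rw [← (summable_bernoulliPrimitive ha (y + 1)).tsum_sub (summable_bernoulliPrimitive ha y)]
  refine tsum_congr fun n => ?_
  rw [← mul_sub, bernoulliPrimitive_step]

end Series

/-! ### Taylor remainders and logistic averages -/

/-- Taylor's formula on a disc for a chain `F j` of successive derivatives, with the crude remainder
`ε R ^ m` where `ε` bounds the derivative of order `m`. -/
theorem norm_sub_taylor_le {F : ℕ → ℂ → ℂ} {c : ℂ} {R : ℝ}
    (hF : ∀ j, ∀ z ∈ Metric.closedBall c R, HasDerivAt (F j) (F (j + 1) z) z) (m k : ℕ) {ε : ℝ}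
    (hε : ∀ z ∈ Metric.closedBall c R, ‖F (k + m) z‖ ≤ ε) {u : ℂ} (hu : ‖u‖ ≤ R) :
    ‖F k (c + u) - ∑ j ∈ Finset.range m, F (k + j) c / (j ! : ℂ) * u ^ j‖ ≤ ε * R ^ m := by
  induction m generalizing k u with
  | zero => simpa using hε (c + u) (by simpa using hu)
  | succ m ih =>
    have hR : 0 ≤ R := (norm_nonneg u).trans hu
    have hd : ∀ v ∈ Metric.closedBall (0 : ℂ) R, HasDerivWithinAt
        (fun v => F k (c + v) - ∑ j ∈ Finset.range (m + 1), F (k + j) c / (j ! : ℂ) * v ^ j)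
        (F (k + 1) (c + v) - ∑ j ∈ Finset.range m, F (k + 1 + j) c / (j ! : ℂ) * v ^ j)
        (Metric.closedBall (0 : ℂ) R) v := by
      intro v hv
      have h1 := (hF k (c + v) (by simpa using hv)).comp_const_add c v
      have h2 : HasDerivAt
          (fun v : ℂ => ∑ j ∈ Finset.range (m + 1), F (k + j) c / (j ! : ℂ) * v ^ j)
          (∑ j ∈ Finset.range (m + 1), F (k + j) c / (j ! : ℂ) * (j * v ^ (j - 1))) v :=
        HasDerivAt.fun_sum fun j _ => (hasDerivAt_pow j v).const_mul _
      refine ((h1.sub h2).congr_deriv ?_).hasDerivWithinAt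
      congr 1
      rw [Finset.sum_range_succ']
      simp only [Nat.cast_zero, zero_mul, mul_zero, add_zero]
      refine Finset.sum_congr rfl fun j _ => ?_
      have hj : (j : ℂ) + 1 ≠ 0 := by exact_mod_cast j.succ_ne_zero
      rw [Nat.factorial_succ, show k + (j + 1) = k + 1 + j by ring]
      push_cast
      field_simp
    have hb : ∀ v ∈ Metric.closedBall (0 : ℂ) R,
        ‖F (k + 1) (c + v) - ∑ j ∈ Finset.range m, F (k + 1 + j) c / (j ! : ℂ) * v ^ j‖ ≤
          ε * R ^ m := fun v hv => ih (k + 1)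
            (fun z hz => by rw [show k + 1 + m = k + (m + 1) by ring]; exact hε z hz)
            (by simpa using hv)
    have h := (convex_closedBall (0 : ℂ) R).norm_image_sub_le_of_norm_hasDerivWithin_le hd hb
      (x := 0) (y := u) (by simpa using hR) (by simpa using hu)
    rw [Finset.sum_range_succ' _ m] at h
    have hε0 : 0 ≤ ε := (norm_nonneg _).trans (hε c (by simpa using hR))
    calc _ ≤ ε * R ^ m * ‖u - 0‖ := by
            refine le_trans (le_of_eq ?_) h
            congr 1
            simp [Finset.sum_range_succ']
      _ ≤ ε * R ^ m * R := by rw [sub_zero]; gcongr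
      _ = _ := by ring

theorem isOpen_rightHalfPlane : IsOpen rightHalfPlane :=
  isOpen_lt continuous_const Complex.continuous_re

theorem hasDerivAt_iteratedDeriv {f : ℂ → ℂ} (hf : DifferentiableOn ℂ f rightHalfPlane) (k : ℕ)
    {z : ℂ} (hz : 0 < z.re) : HasDerivAt (iteratedDeriv k f) (iteratedDeriv (k + 1) f z) z := by
  have : DifferentiableOn ℂ (iteratedDeriv k f) rightHalfPlane := by
    induction k with
    | zero => simpa using hf
    | succ k ih => rw [iteratedDeriv_succ]; exact ih.deriv isOpen_rightHalfPlane
  rw [iteratedDeriv_succ]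
  exact (this.differentiableAt (isOpen_rightHalfPlane.mem_nhds hz)).hasDerivAt

/-- The limit condition of the class `𝒯`, with the logistic density in place of its majorant
`exp (-2π|ξ|)`. -/
theorem eventually_norm_integral_taylorRemainder_le {f : ℂ → ℂ} {p : ℕ}
    (hT : MemT p (-(2 * Real.pi)) 0 (2 * Real.pi) 0 f) (R : ℝ) {ε : ℝ} (hε : 0 < ε) :
    ∀ᶠ x : ℝ in atTop, ∀ η ∈ Set.Icc (-R) R,
      ‖∫ ξ : ℝ, taylorRemainder f p (x + η * Complex.I) ξ * (logisticDensity ξ : ℂ)‖ ≤ ε := by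
  have hδ : 0 < ε / (2 * Real.pi) / 2 := by positivity
  filter_upwards [hT.limit_pos _ (isCompact_Icc (a := -R) (b := R)) _ (ENNReal.ofReal_pos.2 hδ),
    hT.limit_neg _ (isCompact_Icc (a := -R) (b := R)) _ (ENNReal.ofReal_pos.2 hδ)] with x h1 h2 η hη
  have h1 := h1 η hη
  have h2 := h2 η hη
  set T : ℝ → ℂ := taylorRemainder f p (x + η * Complex.I) with hTd
  have hle : ∀ ξ : ℝ, ‖T ξ * (logisticDensity ξ : ℂ)‖ₑ ≤ ENNReal.ofReal (2 * Real.pi) *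
      ENNReal.ofReal (‖T ξ‖ * Real.exp (-(2 * Real.pi * |ξ|))) := by
    intro ξ
    rw [← ENNReal.ofReal_mul (by positivity), ← ofReal_norm, norm_mul, Complex.norm_real,
      Real.norm_of_nonneg (logisticDensity_nonneg _)]
    refine ENNReal.ofReal_le_ofReal ?_
    calc ‖T ξ‖ * logisticDensity ξ ≤ ‖T ξ‖ * (2 * Real.pi * Real.exp (-(2 * Real.pi * |ξ|))) := by
          gcongr; exact logisticDensity_le ξ
      _ = _ := by ring
  have hI : ∫⁻ ξ in Set.Ioi (0 : ℝ), ‖T ξ * (logisticDensity ξ : ℂ)‖ₑ ≤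
      ENNReal.ofReal (2 * Real.pi) * ENNReal.ofReal (ε / (2 * Real.pi) / 2) := by
    refine (setLIntegral_mono' measurableSet_Ioi fun ξ _ => hle ξ).trans ?_
    rw [lintegral_const_mul' _ _ ENNReal.ofReal_ne_top]
    gcongr
    refine le_trans (le_of_eq ?_) h1.le
    refine setLIntegral_congr_fun measurableSet_Ioi fun ξ hξ => ?_
    simp [abs_of_pos (Set.mem_Ioi.1 hξ)]
  have hJ : ∫⁻ ξ in Set.Iio (0 : ℝ), ‖T ξ * (logisticDensity ξ : ℂ)‖ₑ ≤
      ENNReal.ofReal (2 * Real.pi) * ENNReal.ofReal (ε / (2 * Real.pi) / 2) := by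
    refine (setLIntegral_mono' measurableSet_Iio fun ξ _ => hle ξ).trans ?_
    rw [lintegral_const_mul' _ _ ENNReal.ofReal_ne_top]
    gcongr
    refine le_trans (le_of_eq ?_) h2.le
    refine setLIntegral_congr_fun measurableSet_Iio fun ξ hξ => ?_
    simp [abs_of_neg (Set.mem_Iio.1 hξ)]
  have hfull : ∫⁻ ξ : ℝ, ‖T ξ * (logisticDensity ξ : ℂ)‖ₑ ≤ ENNReal.ofReal ε := by
    rw [← lintegral_add_compl _ (measurableSet_Ioi (a := (0 : ℝ))), Set.compl_Ioi,
      setLIntegral_congr Iio_ae_eq_Iic.symm]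
    refine (add_le_add hI hJ).trans (le_of_eq ?_)
    rw [← ENNReal.ofReal_mul (by positivity), ← ENNReal.ofReal_add (by positivity) (by positivity)]
    congr 1
    field_simp
    ring
  have := (enorm_integral_le_lintegral_enorm
    (fun ξ : ℝ => T ξ * (logisticDensity ξ : ℂ))).trans hfull
  rw [← ofReal_norm] at this
  exact (ENNReal.ofReal_le_ofReal_iff hε.le).1 this

theorem integrable_mul_logisticDensity {f : ℂ → ℂ} {p : ℕ}
    (hT : MemT p (-(2 * Real.pi)) 0 (2 * Real.pi) 0 f) {t : ℂ} (ht : 0 < t.re) :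
    Integrable fun ξ : ℝ => f (t + ξ * Complex.I) * (logisticDensity ξ : ℂ) := by
  have hre : ∀ ξ : ℝ, 0 < (t + ξ * Complex.I).re := fun ξ => by simpa using ht
  have hcont : Continuous fun ξ : ℝ => f (t + ξ * Complex.I) :=
    hT.holo.continuousOn.comp_continuous (by fun_prop) hre
  have hw := continuous_logisticDensity
  have hmeas : Continuous fun ξ : ℝ => f (t + ξ * Complex.I) * (logisticDensity ξ : ℂ) := by
    exact hcont.mul (Complex.continuous_ofReal.comp hw)
  have hle : ∀ ξ : ℝ, ‖f (t + ξ * Complex.I) * (logisticDensity ξ : ℂ)‖ ≤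
      2 * Real.pi * (‖f (t + ξ * Complex.I)‖ * Real.exp (-(2 * Real.pi * |ξ|))) := by
    intro ξ
    rw [norm_mul, Complex.norm_real, Real.norm_of_nonneg (logisticDensity_nonneg _)]
    calc _ ≤ ‖f (t + ξ * Complex.I)‖ * (2 * Real.pi * Real.exp (-(2 * Real.pi * |ξ|))) := by
          gcongr; exact logisticDensity_le ξ
      _ = _ := by ring
  have h1 : IntegrableOn (fun ξ : ℝ => f (t + ξ * Complex.I) * (logisticDensity ξ : ℂ))
      (Set.Ioi 0) := by
    refine Integrable.mono' ((hT.integrable_pos t ht).const_mul (2 * Real.pi))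
      hmeas.aestronglyMeasurable ?_
    refine (ae_restrict_mem measurableSet_Ioi).mono fun ξ hξ => (hle ξ).trans (le_of_eq ?_)
    simp [abs_of_pos (Set.mem_Ioi.1 hξ)]
  have h2 : IntegrableOn (fun ξ : ℝ => f (t + ξ * Complex.I) * (logisticDensity ξ : ℂ))
      (Set.Iio 0) := by
    refine Integrable.mono' ((hT.integrable_neg t ht).const_mul (2 * Real.pi))
      hmeas.aestronglyMeasurable ?_
    refine (ae_restrict_mem measurableSet_Iio).mono fun ξ hξ => (hle ξ).trans (le_of_eq ?_)
    simp [abs_of_neg (Set.mem_Iio.1 hξ)]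
  have h3 := (h2.congr_set_ae Iio_ae_eq_Iic.symm).union h1
  rwa [Set.Iic_union_Ioi, integrableOn_univ] at h3

/-- The logistic moment `∫ (iξ) ^ k w(ξ) dξ`. -/
noncomputable def logisticMoment (k : ℕ) : ℂ :=
  ∫ ξ : ℝ, ((ξ : ℂ) * Complex.I) ^ k * (logisticDensity ξ : ℂ)

theorem integral_mul_logisticDensity_eq {f : ℂ → ℂ} {p : ℕ}
    (hT : MemT p (-(2 * Real.pi)) 0 (2 * Real.pi) 0 f) {t : ℂ} (ht : 0 < t.re) :
    ∫ ξ : ℝ, f (t + ξ * Complex.I) * (logisticDensity ξ : ℂ) =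
      (∫ ξ : ℝ, taylorRemainder f p t ξ * (logisticDensity ξ : ℂ)) +
        ∑ k ∈ Finset.range p, logisticMoment k / (k ! : ℂ) * iteratedDeriv k f t := by
  have hm : ∀ k : ℕ, Integrable fun ξ : ℝ => iteratedDeriv k f t / (k ! : ℂ) *
      (((ξ : ℂ) * Complex.I) ^ k * (logisticDensity ξ : ℂ)) := fun k => by
    simpa using (integrable_add_mul_I_pow_mul_logisticDensity 0 k).const_mul
      (iteratedDeriv k f t / (k ! : ℂ))
  have hs := integrable_finsetSum (Finset.range p) fun k _ => hm k
  have h := integral_sub (integrable_mul_logisticDensity hT ht) hs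
  rw [integral_finsetSum _ fun k _ => hm k] at h
  simp_rw [integral_const_mul] at h
  have e : ∀ ξ : ℝ, taylorRemainder f p t ξ * (logisticDensity ξ : ℂ) =
      f (t + ξ * Complex.I) * (logisticDensity ξ : ℂ) - ∑ k ∈ Finset.range p,
        iteratedDeriv k f t / (k ! : ℂ) *
          (((ξ : ℂ) * Complex.I) ^ k * (logisticDensity ξ : ℂ)) := by
    intro ξ
    rw [taylorRemainder, sub_mul, Finset.sum_mul]
    simp_rw [mul_assoc]
  simp_rw [e]
  rw [h, eq_comm, sub_add_eq_add_sub, sub_eq_iff_eq_add]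
  congr 1
  refine Finset.sum_congr rfl fun k _ => ?_
  rw [logisticMoment]; ring

theorem norm_integral_mul_logisticDensity_le {ψ : ℝ → ℂ} {B : ℝ} (hψ : ∀ ξ, ‖ψ ξ‖ ≤ B) :
    ‖∫ ξ : ℝ, ψ ξ * (logisticDensity ξ : ℂ)‖ ≤ 2 * B := by
  have hB : 0 ≤ B := (norm_nonneg _).trans (hψ 0)
  have hi := integrable_add_mul_I_pow_mul_logisticDensity 0 0
  have hb := integral_norm_pow_mul_logisticDensity_le 0 0
  simp only [pow_zero, one_mul] at hi hb
  norm_num at hb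
  calc _ ≤ ∫ ξ : ℝ, B * ‖(logisticDensity ξ : ℂ)‖ :=
        norm_integral_le_of_norm_le (hi.norm.const_mul B) (ae_of_all _ fun ξ => by
          rw [norm_mul]; gcongr; exact hψ ξ)
    _ = B * ∫ ξ : ℝ, ‖(logisticDensity ξ : ℂ)‖ := integral_const_mul _ _
    _ ≤ B * 2 := by
        gcongr
        simpa using hb
    _ = 2 * B := mul_comm _ _

/-! ### Asymptotic polynomiality of the termwise primitive -/

/-- The polynomial with zero constant term whose derivative replaces, in
`∑_{k<p} μ_k / k! * f^{(k)}(c + u)`, each `f^{(k)}` by its Taylor polynomial at `c` of degree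
less than `p - k`; here `μ_k` are the logistic moments. -/
noncomputable def momentTaylorPolynomial (f : ℂ → ℂ) (p : ℕ) (c : ℂ) : Polynomial ℂ :=
  ∑ k ∈ Finset.range p, ∑ j ∈ Finset.range (p - k),
    Polynomial.C (logisticMoment k / (k ! : ℂ) * (iteratedDeriv (k + j) f c / ((j + 1)! : ℂ))) *
      Polynomial.X ^ (j + 1)

theorem natDegree_momentTaylorPolynomial_le (f : ℂ → ℂ) (p : ℕ) (c : ℂ) :
    (momentTaylorPolynomial f p c).natDegree ≤ p := by
  refine Polynomial.natDegree_sum_le_of_forall_le _ _ fun k _ =>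
    Polynomial.natDegree_sum_le_of_forall_le _ _ fun j hj =>
      (Polynomial.natDegree_C_mul_X_pow_le _ _).trans ?_
  have := Finset.mem_range.1 hj
  omega

theorem eval_zero_momentTaylorPolynomial (f : ℂ → ℂ) (p : ℕ) (c : ℂ) :
    (momentTaylorPolynomial f p c).eval 0 = 0 := by
  simp [momentTaylorPolynomial, Polynomial.eval_finsetSum]

theorem eval_derivative_momentTaylorPolynomial (f : ℂ → ℂ) (p : ℕ) (c u : ℂ) :
    (momentTaylorPolynomial f p c).derivative.eval u =
      ∑ k ∈ Finset.range p, logisticMoment k / (k ! : ℂ) *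
        ∑ j ∈ Finset.range (p - k), iteratedDeriv (k + j) f c / (j ! : ℂ) * u ^ j := by
  simp only [momentTaylorPolynomial, Polynomial.derivative_sum, Polynomial.eval_finsetSum,
    Finset.mul_sum]
  refine Finset.sum_congr rfl fun k _ => Finset.sum_congr rfl fun j _ => ?_
  have hj : (j : ℂ) + 1 ≠ 0 := by exact_mod_cast j.succ_ne_zero
  rw [Polynomial.derivative_C_mul_X_pow, Nat.factorial_succ]
  simp only [Polynomial.eval_mul, Polynomial.eval_C, Polynomial.eval_pow, Polynomial.eval_X]
  push_cast
  field_simp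

theorem eventually_norm_iteratedDeriv_le {f : ℂ → ℂ} {p : ℕ}
    (hlim : TendstoLocallyUniformly
      (fun (t : ℝ) (ξ : ℝ) => iteratedDeriv p f ((t : ℂ) + ξ * Complex.I)) (fun _ => 0) atTop)
    (R : ℝ) {ε : ℝ} (hε : 0 < ε) :
    ∀ᶠ x : ℝ in atTop, ∀ η ∈ Set.Icc (-R) R, ‖iteratedDeriv p f (x + η * Complex.I)‖ ≤ ε := by
  have h := (tendstoLocallyUniformly_iff_forall_isCompact.1 hlim) _
    (isCompact_Icc (a := -R) (b := R))
  filter_upwards [Metric.tendstoUniformlyOn_iff.1 h ε hε] with x hx η hη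
  have := hx η hη
  rw [dist_zero_left] at this
  exact this.le

/-- Eventual validity as `Re t → ∞`, uniform for `Im t ∈ [-R, R]`, restricts to the discs of radius
`R` around the points `n + 1/2`. -/
theorem eventually_forall_norm_le_of_eventually_re {S : ℂ → Prop} {R : ℝ}
    (h : ∀ᶠ x : ℝ in atTop, ∀ η ∈ Set.Icc (-R) R, S (x + η * Complex.I)) :
    ∀ᶠ n : ℕ in atTop, ∀ u : ℂ, ‖u‖ ≤ R → S (n + 1 / 2 + u) := by
  obtain ⟨x₀, hx₀⟩ := eventually_atTop.1 h
  filter_upwards [eventually_ge_atTop ⌈x₀ + R⌉₊] with n hn u hu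
  have hn' : x₀ + R ≤ n := (Nat.le_ceil _).trans (by exact_mod_cast hn)
  have hre := (Complex.abs_re_le_norm u).trans hu
  have him := (Complex.abs_im_le_norm u).trans hu
  have := hx₀ (n + 1 / 2 + u.re) (by linarith [(abs_le.1 hre).1]) u.im (abs_le.1 him)
  convert! this using 1
  apply Complex.ext <;> simp

/-- If `G' (y)` is the logistic average of `g` over the line through `y + 1 / 2`, and `g` differs
from a function of class `𝒯` by a function decaying like `1 / Re z`, then `G (n + y) - G n` is
asymptotically polynomial in `y`. -/
theorem exists_polynomial_tendsto_sub {f g h G : ℂ → ℂ} {p : ℕ} {B : ℝ}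
    (hT : MemT p (-(2 * Real.pi)) 0 (2 * Real.pi) 0 f)
    (hlim : TendstoLocallyUniformly
      (fun (t : ℝ) (ξ : ℝ) => iteratedDeriv p f ((t : ℂ) + ξ * Complex.I)) (fun _ => 0) atTop)
    (hfg : ∀ z : ℂ, 0 < z.re → f z = h z + g z)
    (hhc : ContinuousOn h rightHalfPlane) (hh : ∀ z : ℂ, 1 ≤ z.re → ‖h z‖ ≤ B / z.re)
    (hG : ∀ y, HasDerivAt G
      (∫ ξ : ℝ, g (y + 1 / 2 + ξ * Complex.I) * (logisticDensity ξ : ℂ)) y) :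
    ∃ P : ℕ → Polynomial ℂ, (∀ n, (P n).natDegree ≤ p) ∧
      ∀ y, Tendsto (fun n : ℕ => G (n + y) - G n - (P n).eval y) atTop (𝓝 0) := by
  refine ⟨fun n => momentTaylorPolynomial f p (n + 1 / 2),
    fun n => natDegree_momentTaylorPolynomial_le _ _ _, fun y => ?_⟩
  set R : ℝ := ‖y‖ with hR
  have hR0 : 0 ≤ R := norm_nonneg y
  set A : ℝ := ∑ k ∈ Finset.range p, ‖logisticMoment k / (k ! : ℂ)‖ * R ^ (p - k) with hA
  have hA0 : 0 ≤ A := Finset.sum_nonneg fun k _ => by positivity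
  -- the derivative of the error is small on the disc of radius `R`
  have key : ∀ δ > 0, ∀ᶠ n : ℕ in atTop, ∀ u : ℂ, ‖u‖ ≤ R →
      ‖(∫ ξ : ℝ, g (n + u + 1 / 2 + ξ * Complex.I) * (logisticDensity ξ : ℂ)) -
        (momentTaylorPolynomial f p (n + 1 / 2)).derivative.eval u‖ ≤ δ * (A + 3) := by
    intro δ hδ
    have e1 := eventually_forall_norm_le_of_eventually_re
      (S := fun t => ‖∫ ξ : ℝ, taylorRemainder f p t ξ * (logisticDensity ξ : ℂ)‖ ≤ δ)
      (eventually_norm_integral_taylorRemainder_le hT R hδ)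
    have e2 := eventually_forall_norm_le_of_eventually_re (S := fun t => ‖iteratedDeriv p f t‖ ≤ δ)
      (eventually_norm_iteratedDeriv_le hlim R hδ)
    have e3 := eventually_forall_norm_le_of_eventually_re (R := R)
      (S := fun t => 1 ≤ t.re ∧ B / t.re ≤ δ) (by
      have hB : Tendsto (fun x : ℝ => B / x) atTop (𝓝 0) := tendsto_const_nhds.div_atTop tendsto_id
      filter_upwards [eventually_ge_atTop 1, hB.eventually_le_const hδ] with x h1 h2 η _
      simpa using ⟨h1, h2⟩)
    filter_upwards [e1, e2, e3] with n h1 h2 h3 u hu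
    set c : ℂ := n + 1 / 2 with hc
    have ht : 0 < (c + u).re := by linarith [(h3 u hu).1]
    have hre : ∀ ξ : ℝ, (c + u + ξ * Complex.I).re = (c + u).re := fun ξ => by simp
    have hhb : ∀ ξ : ℝ, ‖h (c + u + ξ * Complex.I)‖ ≤ δ := fun ξ => by
      have := hh (c + u + ξ * Complex.I) (by rw [hre]; exact (h3 u hu).1)
      rw [hre] at this
      exact this.trans (h3 u hu).2
    have hI : (∫ ξ : ℝ, g (n + u + 1 / 2 + ξ * Complex.I) * (logisticDensity ξ : ℂ)) =
        (∫ ξ : ℝ, f (c + u + ξ * Complex.I) * (logisticDensity ξ : ℂ)) -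
          ∫ ξ : ℝ, h (c + u + ξ * Complex.I) * (logisticDensity ξ : ℂ) := by
      have hhi : Integrable fun ξ : ℝ =>
          h (c + u + ξ * Complex.I) * (logisticDensity ξ : ℂ) := by
        have hi := integrable_add_mul_I_pow_mul_logisticDensity 0 0
        simp only [pow_zero, one_mul] at hi
        refine hi.bdd_mul (c := δ) ?_ (ae_of_all _ hhb)
        refine (hhc.comp_continuous (by fun_prop) fun ξ => ?_).aestronglyMeasurable
        have : 0 < (c + u + ξ * Complex.I).re := by rw [hre]; exact ht
        exact this
      rw [← integral_sub (integrable_mul_logisticDensity hT ht) hhi]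
      refine integral_congr_ae (ae_of_all _ fun ξ => ?_)
      have : f (c + u + ξ * Complex.I) = _ := hfg _ (by rw [hre]; exact ht)
      simp only [this]
      rw [show (n : ℂ) + u + 1 / 2 = c + u by rw [hc]; ring]
      ring
    have hhI : ‖∫ ξ : ℝ, h (c + u + ξ * Complex.I) * (logisticDensity ξ : ℂ)‖ ≤ 2 * δ :=
      norm_integral_mul_logisticDensity_le hhb
    have hball : ∀ z ∈ Metric.closedBall c R, ∃ v : ℂ, ‖v‖ ≤ R ∧ z = c + v := fun z hz =>
      ⟨z - c, by simpa [dist_eq_norm] using hz, by ring⟩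
    have hTay : ∀ k ∈ Finset.range p, ‖iteratedDeriv k f (c + u) -
        ∑ j ∈ Finset.range (p - k), iteratedDeriv (k + j) f c / (j ! : ℂ) * u ^ j‖ ≤
          δ * R ^ (p - k) := by
      intro k hk
      have hk' := Finset.mem_range.1 hk
      refine norm_sub_taylor_le (F := fun j => iteratedDeriv j f) (fun j z hz => ?_) (p - k) k
        (fun z hz => ?_) hu
      · obtain ⟨v, hv, rfl⟩ := hball z hz
        exact hasDerivAt_iteratedDeriv hT.holo j (by linarith [(h3 v hv).1])
      · obtain ⟨v, hv, rfl⟩ := hball z hz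
        rw [show k + (p - k) = p by omega]
        exact h2 v hv
    rw [hI, integral_mul_logisticDensity_eq hT ht, eval_derivative_momentTaylorPolynomial]
    -- the error splits into the `𝒯`-remainder, the part of `h`, and the Taylor errors of `f^{(k)}`
    have hsplit : ∀ a s b q : ℂ, a + s - b - q = a - b + (s - q) := fun a s b q => by ring
    rw [hsplit, ← Finset.sum_sub_distrib]
    simp_rw [← mul_sub]
    have hsum : ‖∑ k ∈ Finset.range p, logisticMoment k / (k ! : ℂ) *
        (iteratedDeriv k f (c + u) - ∑ j ∈ Finset.range (p - k),
          iteratedDeriv (k + j) f c / (j ! : ℂ) * u ^ j)‖ ≤ δ * A := by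
      rw [hA, Finset.mul_sum]
      refine norm_sum_le_of_le _ fun k hk => ?_
      rw [norm_mul]
      calc _ ≤ ‖logisticMoment k / (k ! : ℂ)‖ * (δ * R ^ (p - k)) := by
            gcongr; exact hTay k hk
        _ = _ := by ring
    calc _ ≤ (δ + 2 * δ) + δ * A :=
          (norm_add_le _ _).trans (add_le_add ((norm_sub_le _ _).trans
            (add_le_add (h1 u hu) hhI)) hsum)
      _ = _ := by ring
  rw [Metric.tendsto_nhds]
  intro ε hε
  have hpos : 0 < ε / 2 / ((A + 3) * (R + 1)) := by positivity
  filter_upwards [key _ hpos] with n hn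
  have hd : ∀ u ∈ Metric.closedBall (0 : ℂ) R, HasDerivWithinAt
      (fun u => G (n + u) - (momentTaylorPolynomial f p (n + 1 / 2)).eval u)
      ((∫ ξ : ℝ, g (n + u + 1 / 2 + ξ * Complex.I) * (logisticDensity ξ : ℂ)) -
        (momentTaylorPolynomial f p (n + 1 / 2)).derivative.eval u)
      (Metric.closedBall (0 : ℂ) R) u := fun u _ =>
    (((hG (n + u)).comp_const_add (n : ℂ) u).sub
      ((momentTaylorPolynomial f p (n + 1 / 2)).hasDerivAt u)).hasDerivWithinAt
  -- mean value inequality on the segment from `0` to `y`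
  have hm := (convex_closedBall (0 : ℂ) R).norm_image_sub_le_of_norm_hasDerivWithin_le hd
    (fun u hu => hn u (by simpa using hu)) (x := 0) (y := y) (by simpa using hR0)
    (by simp [hR])
  rw [eval_zero_momentTaylorPolynomial, sub_zero, add_zero, sub_zero, ← hR] at hm
  rw [dist_zero_right]
  calc _ = ‖G (n + y) - (momentTaylorPolynomial f p (n + 1 / 2)).eval y - G n‖ := by
        congr 1; ring
    _ ≤ _ := hm
    _ = ε / 2 * (R / (R + 1)) := by
        field_simp
    _ ≤ ε / 2 * 1 := by
        gcongr
        rw [div_le_one (by positivity)]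
        linarith
    _ < ε := by linarith

/-! ### Müller–Schleicher primitives -/

theorem sum_Icc_one_eq_sum_range (F : ℕ → ℂ) (n : ℕ) :
    ∑ k ∈ Finset.Icc 1 n, F k = ∑ k ∈ Finset.range n, F (k + 1) := by
  induction n with
  | zero => simp
  | succ n ih => rw [Finset.sum_Icc_succ_top (by omega), ih, Finset.sum_range_succ]

namespace IsMSPrimitive

theorem msSum_eq {U : Set ℂ} (hU : IsMSDomain U) {f Q : ℂ → ℂ} (h : IsMSPrimitive U f Q) {x y : ℂ}
    (hx : x ∈ U) (hy : y + 1 ∈ U) : msSum U f x y = Q y - Q (x - 1) := by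
  have hs : MSSummable U f := ⟨Q, h⟩
  rw [msSum, dif_pos hs]
  exact sub_eq_sub hU hs.choose_spec h hx hy

theorem congr {U : Set ℂ} (hU : IsMSDomain U) {f f' Q : ℂ → ℂ} (h : IsMSPrimitive U f Q)
    (hff : ∀ z ∈ U, f' z = f z) : IsMSPrimitive U f' Q := by
  have hadd : ∀ (y : ℂ), y + 1 ∈ U → ∀ k : ℕ, ((k + 1 : ℕ) : ℂ) + y ∈ U := by
    intro y hy k
    induction k with
    | zero => simpa [add_comm] using hy
    | succ k ih =>
      have := hU.add_one_mem _ ih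
      rwa [show ((k + 1 : ℕ) : ℂ) + y + 1 = ((k + 1 + 1 : ℕ) : ℂ) + y by push_cast; ring] at this
  obtain ⟨P, hd, hP⟩ := h.limit
  refine ⟨⟨P, hd, fun y hy => (hP y hy).congr fun n => ?_⟩, fun y hy => by
    rw [hff _ hy]; exact h.step y hy⟩
  congr 1
  refine Finset.sum_congr rfl fun k hk => ?_
  obtain ⟨j, rfl⟩ := Nat.exists_eq_add_of_le' (Finset.mem_Icc.1 hk).1
  have h0 := hadd 0 (by simpa using hU.one_mem) j
  rw [add_zero] at h0
  rw [hff _ (hadd y hy j), hff _ h0]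

theorem add {U : Set ℂ} {f f' Q Q' : ℂ → ℂ} (h : IsMSPrimitive U f Q)
    (h' : IsMSPrimitive U f' Q') :
    IsMSPrimitive U (fun z => f z + f' z) (fun y => Q y + Q' y) := by
  obtain ⟨P, ⟨d, hd⟩, hP⟩ := h.limit
  obtain ⟨P', ⟨d', hd'⟩, hP'⟩ := h'.limit
  refine ⟨⟨fun n => P n + P' n, ⟨max d d', fun n =>
    (Polynomial.natDegree_add_le _ _).trans (max_le_max (hd n) (hd' n))⟩, fun y hy => ?_⟩,
    fun y hy => ?_⟩
  · rw [neg_add]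
    refine ((hP y hy).add (hP' y hy)).congr fun n => ?_
    simp only [Polynomial.eval_add, Finset.sum_sub_distrib, Finset.sum_add_distrib]
    ring
  · linear_combination h.step y hy + h'.step y hy

theorem zero (U : Set ℂ) : IsMSPrimitive U (fun _ => 0) (fun _ => 0) :=
  ⟨⟨fun _ => 0, ⟨0, by simp⟩, by simp⟩, by simp⟩

theorem sum {U : Set ℂ} {ι : Type*} (s : Finset ι) {f Q : ι → ℂ → ℂ}
    (h : ∀ i ∈ s, IsMSPrimitive U (f i) (Q i)) :
    IsMSPrimitive U (fun z => ∑ i ∈ s, f i z) (fun y => ∑ i ∈ s, Q i y) := by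
  classical
  induction s using Finset.induction_on with
  | empty => simpa using zero U
  | insert i s hi ih =>
    simp_rw [Finset.sum_insert hi]
    exact (h i (Finset.mem_insert_self i s)).add
      (ih fun j hj => h j (Finset.mem_insert_of_mem hj))

/-- By telescoping, a solution of the difference equation is an MS primitive as soon as
`Q (n + y) - Q n` is asymptotically polynomial in `y`. -/
theorem of_step {f Q : ℂ → ℂ}
    (hstep : ∀ y : ℂ, y + 1 ∈ rightHalfPlane → Q (y + 1) - Q y = f (y + 1))
    {P : ℕ → Polynomial ℂ} {d : ℕ} (hd : ∀ n, (P n).natDegree ≤ d)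
    (hP : ∀ y : ℂ, y + 1 ∈ rightHalfPlane →
      Tendsto (fun n : ℕ => Q (n + y) - Q n - (P n).eval y) atTop (𝓝 0)) :
    IsMSPrimitive rightHalfPlane f Q := by
  refine ⟨⟨fun n => P n + Polynomial.C (Q 0), ⟨d, fun n => ?_⟩, fun y hy => ?_⟩, hstep⟩
  · rw [Polynomial.natDegree_add_C]; exact hd n
  · have htel : ∀ y : ℂ, y + 1 ∈ rightHalfPlane → ∀ n : ℕ,
        ∑ k ∈ Finset.Icc 1 n, f ((k : ℂ) + y) = Q (n + y) - Q y := by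
      intro y hy n
      rw [sum_Icc_one_eq_sum_range]
      induction n with
      | zero => simp
      | succ n ih =>
        have hre : (y + n) + 1 ∈ rightHalfPlane := by
          have h1 : 0 < (y + 1).re := hy
          have : 0 < (y + n + 1).re := by
            simp only [Complex.add_re, Complex.one_re, Complex.natCast_re] at h1 ⊢
            linarith [(n.cast_nonneg : (0 : ℝ) ≤ n)]
          exact this
        have := hstep _ hre
        rw [Finset.sum_range_succ, ih]
        push_cast
        rw [show (n : ℂ) + 1 + y = y + n + 1 by ring, ← this, add_comm (n : ℂ) y]
        ring
    have h := (hP y hy).sub_const (Q y)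
    rw [zero_sub] at h
    refine h.congr fun n => ?_
    have h0 := htel 0 (by simp [rightHalfPlane]) n
    simp only [add_zero] at h0
    rw [Finset.sum_sub_distrib, htel y hy, h0, Polynomial.eval_add, Polynomial.eval_C]
    ring

theorem monomial (a : ℂ) (n : ℕ) :
    IsMSPrimitive rightHalfPlane (fun z => a * z ^ n) (fun y => a * bernoulliPrimitive n y) := by
  -- `Q (m + y) - Q m` is itself a polynomial in `y`, of degree at most `n + 1`
  set B : Polynomial ℂ := (Polynomial.bernoulli (n + 1)).map (algebraMap ℚ ℂ) with hB
  have hQ : ∀ y, bernoulliPrimitive n y = B.eval (y + 1) / (n + 1) := fun y => by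
    rw [bernoulliPrimitive, hB, Polynomial.eval_map_algebraMap]
  refine of_step (d := n + 1) (P := fun m => Polynomial.C (a / (n + 1)) *
    (Polynomial.taylor ((m : ℂ) + 1) B - Polynomial.C (B.eval ((m : ℂ) + 1))))
    (fun y _ => ?_) (fun m => ?_) (fun y _ => ?_)
  · rw [← mul_sub, bernoulliPrimitive_step]
  · refine (Polynomial.natDegree_C_mul_le _ _).trans ?_
    rw [Polynomial.natDegree_sub_C, Polynomial.natDegree_taylor]
    exact Polynomial.natDegree_map_le.trans (natDegree_bernoulli_le _)
  · refine tendsto_const_nhds.congr fun m => ?_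
    simp only [hQ, Polynomial.eval_mul, Polynomial.eval_sub, Polynomial.eval_C,
      Polynomial.taylor_eval]
    rw [show y + ((m : ℂ) + 1) = m + y + 1 by ring]
    ring

end IsMSPrimitive

/-! ### Primitives of negative powers -/

theorem mul_add_one_le_norm (y : ℂ) (k : ℕ) :
    min 1 (y + 1).re * (k + 1) ≤ ‖((k + 1 : ℕ) : ℂ) + y‖ := by
  refine le_trans ?_ (Complex.re_le_norm _)
  have h1 := min_le_left 1 (y + 1).re
  have h2 := min_le_right 1 (y + 1).re
  have h3 : (((k + 1 : ℕ) : ℂ) + y).re = k + (y + 1).re := by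
    simp only [Complex.add_re, Complex.natCast_re, Complex.one_re]
    push_cast
    ring
  rw [h3]
  nlinarith [(k.cast_nonneg : (0 : ℝ) ≤ k)]

theorem norm_inv_add_le {y : ℂ} (hy : 0 < (y + 1).re) (k : ℕ) :
    ‖(((k + 1 : ℕ) : ℂ) + y)⁻¹‖ ≤ (min 1 (y + 1).re)⁻¹ * (1 / (k + 1)) := by
  have h0 : 0 < min 1 (y + 1).re := lt_min one_pos hy
  rw [norm_inv, one_div, ← mul_inv]
  exact inv_anti₀ (by positivity) (mul_add_one_le_norm y k)

theorem exists_norm_inv_pow_sub_le {y : ℂ} (hy : 0 < (y + 1).re) (m : ℕ) :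
    ∃ C : ℝ, ∀ k : ℕ, ‖(((k + 1 : ℕ) : ℂ) + y)⁻¹ ^ m - ((k + 1 : ℕ) : ℂ)⁻¹ ^ m‖ ≤
      C * (1 / ((k : ℝ) + 1) ^ 2) := by
  have h0 : 0 < min 1 (y + 1).re := lt_min one_pos hy
  set D := (min 1 (y + 1).re)⁻¹ with hD
  have hD0 : 0 < D := inv_pos.2 h0
  have hk1 : ∀ k : ℕ, 1 / ((k : ℝ) + 1) ≤ 1 := fun k => by
    rw [div_le_one (by positivity)]; linarith [(k.cast_nonneg : (0 : ℝ) ≤ k)]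
  have hw : ∀ k : ℕ, ‖((k + 1 : ℕ) : ℂ)⁻¹‖ = 1 / ((k : ℝ) + 1) := fun k => by
    rw [norm_inv, Complex.norm_natCast]; push_cast; rw [one_div]
  have hz : ∀ k : ℕ, ‖(((k + 1 : ℕ) : ℂ) + y)⁻¹‖ ≤ D * (1 / ((k : ℝ) + 1)) := norm_inv_add_le hy
  have hdiff : ∀ k : ℕ, ‖(((k + 1 : ℕ) : ℂ) + y)⁻¹ - ((k + 1 : ℕ) : ℂ)⁻¹‖ ≤
      ‖y‖ * D * (1 / ((k : ℝ) + 1) ^ 2) := by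
    intro k
    have hz0 : ((k + 1 : ℕ) : ℂ) + y ≠ 0 := by
      refine norm_pos_iff.1 (lt_of_lt_of_le ?_ (mul_add_one_le_norm y k))
      positivity
    have hw0 : ((k + 1 : ℕ) : ℂ) ≠ 0 := by exact_mod_cast k.succ_ne_zero
    have : (((k + 1 : ℕ) : ℂ) + y)⁻¹ - ((k + 1 : ℕ) : ℂ)⁻¹ =
        -y * ((((k + 1 : ℕ) : ℂ) + y)⁻¹ * ((k + 1 : ℕ) : ℂ)⁻¹) := by
      field_simp
      ring
    rw [this, norm_mul, norm_mul, norm_neg, hw]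
    calc _ ≤ ‖y‖ * (D * (1 / ((k : ℝ) + 1)) * (1 / ((k : ℝ) + 1))) := by
          gcongr; exact hz k
      _ = _ := by rw [← one_div_pow]; ring
  induction m with
  | zero => exact ⟨0, fun k => by simp⟩
  | succ m ih =>
    obtain ⟨C, hC⟩ := ih
    have hC0 : 0 ≤ C := by simpa using (norm_nonneg _).trans (hC 0)
    refine ⟨C * D + ‖y‖ * D, fun k => ?_⟩
    set z := (((k + 1 : ℕ) : ℂ) + y)⁻¹
    set w := ((k + 1 : ℕ) : ℂ)⁻¹
    have hz' : ‖z‖ ≤ D := (hz k).trans (mul_le_of_le_one_right hD0.le (hk1 k))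
    have hw' : ‖w ^ m‖ ≤ 1 := by
      rw [norm_pow]; exact pow_le_one₀ (norm_nonneg _) ((hw k).trans_le (hk1 k))
    calc ‖z ^ (m + 1) - w ^ (m + 1)‖ = ‖(z ^ m - w ^ m) * z + w ^ m * (z - w)‖ := by
          congr 1; ring
      _ ≤ ‖z ^ m - w ^ m‖ * ‖z‖ + ‖w ^ m‖ * ‖z - w‖ := by
          refine (norm_add_le _ _).trans ?_
          rw [norm_mul, norm_mul]
      _ ≤ C * (1 / ((k : ℝ) + 1) ^ 2) * D + 1 * (‖y‖ * D * (1 / ((k : ℝ) + 1) ^ 2)) := by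
          gcongr
          · exact hC k
          · exact hdiff k
      _ = _ := by ring

/-- The MS primitive `-∑_{k ≥ 1} (b (k + y) ^ (-m) - b k ^ (-m))` of `b z ^ (-m)`. -/
noncomputable def negPowPrimitive (b : ℂ) (m : ℕ) (y : ℂ) : ℂ :=
  -∑' k : ℕ, (b * (((k + 1 : ℕ) : ℂ) + y) ^ (-(m : ℤ)) - b * ((k + 1 : ℕ) : ℂ) ^ (-(m : ℤ)))

theorem summable_negPow_sub (b : ℂ) (m : ℕ) {y : ℂ} (hy : 0 < (y + 1).re) :
    Summable fun k : ℕ =>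
      b * (((k + 1 : ℕ) : ℂ) + y) ^ (-(m : ℤ)) - b * ((k + 1 : ℕ) : ℂ) ^ (-(m : ℤ)) := by
  obtain ⟨C, hC⟩ := exists_norm_inv_pow_sub_le hy m
  have hs : Summable fun k : ℕ => 1 / ((k : ℝ) + 1) ^ 2 := by
    have := (summable_nat_add_iff 1).2 (Real.summable_one_div_nat_pow.2 one_lt_two)
    simpa using this
  refine Summable.of_norm_bounded (hs.mul_left (‖b‖ * C)) fun k => ?_
  rw [← mul_sub, norm_mul, zpow_neg, zpow_neg, zpow_natCast, zpow_natCast, ← inv_pow, ← inv_pow,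
    mul_assoc]
  gcongr
  exact hC k

theorem isMSPrimitive_negPow (b : ℂ) {m : ℕ} (hm : 1 ≤ m) :
    IsMSPrimitive rightHalfPlane (fun z => b * z ^ (-(m : ℤ))) (negPowPrimitive b m) := by
  have hlim : ∀ y : ℂ, 0 < (y + 1).re → Tendsto (fun n : ℕ => ∑ k ∈ Finset.range n,
      (b * (((k + 1 : ℕ) : ℂ) + y) ^ (-(m : ℤ)) - b * ((k + 1 : ℕ) : ℂ) ^ (-(m : ℤ)))) atTop
      (𝓝 (-negPowPrimitive b m y)) := fun y hy => by
    rw [negPowPrimitive, neg_neg]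
    exact (summable_negPow_sub b m hy).hasSum.tendsto_sum_nat
  refine ⟨⟨fun _ => 0, ⟨0, by simp⟩, fun y hy => ?_⟩, fun y hy => ?_⟩
  · simpa [sum_Icc_one_eq_sum_range] using hlim y hy
  · have hy0 : 0 < (y + 1).re := hy
    have hy1 : 0 < (y + 1 + 1).re := by rw [Complex.add_re, Complex.one_re]; positivity
    have h := (hlim y hy0).sub (hlim (y + 1) hy1)
    have hzero : Tendsto (fun n : ℕ => b * (((n + 1 : ℕ) : ℂ) + y) ^ (-(m : ℤ))) atTop (𝓝 0) := by
      have h1 : Tendsto (fun n : ℕ => (((n + 1 : ℕ) : ℂ) + y)⁻¹) atTop (𝓝 0) := by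
        refine squeeze_zero_norm (norm_inv_add_le hy0) ?_
        simpa using tendsto_one_div_add_atTop_nhds_zero_nat.const_mul (min 1 (y + 1).re)⁻¹
      have h2 := (h1.pow m).const_mul b
      rw [zero_pow (by omega), mul_zero] at h2
      refine h2.congr fun n => ?_
      rw [zpow_neg, zpow_natCast, inv_pow]
    have htel : ∀ n : ℕ, (∑ k ∈ Finset.range n,
        (b * (((k + 1 : ℕ) : ℂ) + y) ^ (-(m : ℤ)) - b * ((k + 1 : ℕ) : ℂ) ^ (-(m : ℤ)))) -
        (∑ k ∈ Finset.range n,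
        (b * (((k + 1 : ℕ) : ℂ) + (y + 1)) ^ (-(m : ℤ)) -
          b * ((k + 1 : ℕ) : ℂ) ^ (-(m : ℤ)))) =
        b * (y + 1) ^ (-(m : ℤ)) - b * (((n + 1 : ℕ) : ℂ) + y) ^ (-(m : ℤ)) := by
      intro n
      induction n with
      | zero => simp [add_comm]
      | succ n ih =>
        rw [Finset.sum_range_succ, Finset.sum_range_succ, add_sub_add_comm, ih,
          show ((n + 1 : ℕ) : ℂ) + (y + 1) = ((n + 1 + 1 : ℕ) : ℂ) + y by push_cast; ring]
        ring
    simp_rw [htel] at h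
    have := tendsto_nhds_unique h (hzero.const_sub _)
    linear_combination this

theorem norm_sum_negPow_le (M : ℕ) (b : ℕ → ℂ) {z : ℂ} (hz : 1 ≤ z.re) :
    ‖∑ m ∈ Finset.Icc 1 M, b m * z ^ (-(m : ℤ))‖ ≤ (∑ m ∈ Finset.Icc 1 M, ‖b m‖) / z.re := by
  rw [Finset.sum_div]
  refine norm_sum_le_of_le _ fun m hm => ?_
  obtain ⟨j, rfl⟩ := Nat.exists_eq_add_of_le' (Finset.mem_Icc.1 hm).1
  rw [norm_mul, zpow_neg, zpow_natCast, norm_inv, norm_pow, ← div_eq_mul_inv]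
  have h1 : z.re ≤ ‖z‖ := Complex.re_le_norm z
  gcongr
  rw [pow_succ]
  have := one_le_pow₀ (hz.trans h1) (n := j)
  nlinarith

theorem continuousOn_sum_negPow (M : ℕ) (b : ℕ → ℂ) :
    ContinuousOn (fun z : ℂ => ∑ m ∈ Finset.Icc 1 M, b m * z ^ (-(m : ℤ))) rightHalfPlane := by
  refine continuousOn_finsetSum _ fun m _ => continuousOn_const.mul ?_
  refine continuousOn_id.zpow₀ _ fun z hz => Or.inl ?_
  have hz : 0 < z.re := hz
  rintro rfl
  simp at hz

end FracSum

theorem corollary3p3 (f : ℂ → ℂ) (M : ℕ) (b a : ℕ → ℂ) (p : ℕ)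
    (hf : ∀ z : ℂ, 0 < z.re →
      f z = (∑ m ∈ Finset.Icc 1 M, b m * z ^ (-(m : ℤ))) + ∑' n : ℕ, a n / (n ! : ℂ) * z ^ n)
    (hT : FracSum.MemT p (-(2 * Real.pi)) 0 (2 * Real.pi) 0 f)
    (hlim : TendstoLocallyUniformly
      (fun (t : ℝ) (ξ : ℝ) => iteratedDeriv p f ((t : ℂ) + ξ * Complex.I)) (fun _ => 0) atTop)
    (ha : Summable fun n : ℕ => (2 * Real.pi) ^ (-(n : ℤ)) * ‖a n‖) :
    FracSum.MSSummable FracSum.rightHalfPlane f ∧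
    (∀ m ∈ Finset.Icc 1 M,
      FracSum.MSSummable FracSum.rightHalfPlane (fun z => b m * z ^ (-(m : ℤ)))) ∧
    (∀ n : ℕ, FracSum.MSSummable FracSum.rightHalfPlane (fun z => a n / (n ! : ℂ) * z ^ n)) ∧
    ∀ α β : ℂ, -1 < α.re → -1 < β.re →
      (Summable fun n : ℕ => FracSum.msSum FracSum.rightHalfPlane
        (fun z => a n / (n ! : ℂ) * z ^ n) (α + 1) β) ∧
      FracSum.msSum FracSum.rightHalfPlane f (α + 1) β =
        (∑ m ∈ Finset.Icc 1 M, FracSum.msSum FracSum.rightHalfPlane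
          (fun z => b m * z ^ (-(m : ℤ))) (α + 1) β) +
        ∑' n : ℕ, FracSum.msSum FracSum.rightHalfPlane
          (fun z => a n / (n ! : ℂ) * z ^ n) (α + 1) β := by
  have hU := FracSum.isMSDomain_rightHalfPlane
  have hneg : ∀ m ∈ Finset.Icc 1 M, FracSum.IsMSPrimitive FracSum.rightHalfPlane
      (fun z => b m * z ^ (-(m : ℤ))) (FracSum.negPowPrimitive (b m) m) := fun m hm =>
    FracSum.isMSPrimitive_negPow (b m) (Finset.mem_Icc.1 hm).1
  have hmon : ∀ n : ℕ, FracSum.IsMSPrimitive FracSum.rightHalfPlane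
      (fun z => a n / (n ! : ℂ) * z ^ n)
      (fun y => a n / (n ! : ℂ) * FracSum.bernoulliPrimitive n y) := fun n =>
    FracSum.IsMSPrimitive.monomial (a n / (n ! : ℂ)) n
  obtain ⟨P, hd, hP⟩ := FracSum.exists_polynomial_tendsto_sub
    (g := fun z => ∑' n : ℕ, a n / (n ! : ℂ) * z ^ n)
    (G := fun y => ∑' n : ℕ, a n / (n ! : ℂ) * FracSum.bernoulliPrimitive n y)
    hT hlim hf (FracSum.continuousOn_sum_negPow M b)
    (fun z hz => FracSum.norm_sum_negPow_le M b hz) (FracSum.hasDerivAt_tsum_bernoulliPrimitive ha)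
  have hentire := FracSum.IsMSPrimitive.of_step
    (f := fun z => ∑' n : ℕ, a n / (n ! : ℂ) * z ^ n)
    (Q := fun y => ∑' n : ℕ, a n / (n ! : ℂ) * FracSum.bernoulliPrimitive n y) (P := P) (d := p)
    (fun y _ => FracSum.tsum_bernoulliPrimitive_step ha y) hd (fun y _ => hP y)
  have hfQ := ((FracSum.IsMSPrimitive.sum _ hneg).add hentire).congr hU (f' := f) hf
  refine ⟨⟨_, hfQ⟩, fun m hm => ⟨_, hneg m hm⟩, fun n => ⟨_, hmon n⟩, fun α β hα hβ => ?_⟩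
  have hα' : α + 1 ∈ FracSum.rightHalfPlane := by
    have : 0 < (α + 1).re := by rw [Complex.add_re, Complex.one_re]; linarith
    exact this
  have hβ' : β + 1 ∈ FracSum.rightHalfPlane := by
    have : 0 < (β + 1).re := by rw [Complex.add_re, Complex.one_re]; linarith
    exact this
  have hterm : ∀ n : ℕ, FracSum.msSum FracSum.rightHalfPlane
      (fun z => a n / (n ! : ℂ) * z ^ n) (α + 1) β =
      a n / (n ! : ℂ) * FracSum.bernoulliPrimitive n β -
        a n / (n ! : ℂ) * FracSum.bernoulliPrimitive n α := by
    intro n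
    rw [(hmon n).msSum_eq hU hα' hβ', add_sub_cancel_right]
  have hnegsum : ∑ m ∈ Finset.Icc 1 M, FracSum.msSum FracSum.rightHalfPlane
      (fun z => b m * z ^ (-(m : ℤ))) (α + 1) β = ∑ m ∈ Finset.Icc 1 M,
        (FracSum.negPowPrimitive (b m) m β - FracSum.negPowPrimitive (b m) m α) :=
    Finset.sum_congr rfl fun m hm => by
      rw [(hneg m hm).msSum_eq hU hα' hβ', add_sub_cancel_right]
  have hsβ := FracSum.summable_bernoulliPrimitive ha β
  have hsα := FracSum.summable_bernoulliPrimitive ha α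
  simp_rw [hterm]
  refine ⟨hsβ.sub hsα, ?_⟩
  rw [hfQ.msSum_eq hU hα' hβ', add_sub_cancel_right, hnegsum, hsβ.tsum_sub hsα,
    Finset.sum_sub_distrib]
  ring
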